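/- Let $E$ be a real Banach lattice. Let $\mathrm{Aut}^+(E)$ be the group of lattice automorphisms of $E$ (bijective bounded linear maps preserving the lattice operations), with the strong operator topology; let $\mathrm{IAut}^+(E)$ be its subgroup of isometric lattice automorphisms, and let $\mathrm{ZAut}^+(E)$ be the set of central lattice automorphisms, i.e. of those $m \in \mathrm{Aut}^+(E)$ for which there is a $\lambda \ge 0$ with $-\lambda x \le mx \le \lambda x$ for all $x \ge 0$. Put $\mathrm{ZAut}^+(E)\cdot \mathrm{IAut}^+(E) = \{m\phi : m \in \mathrm{ZAut}^+(E),\ \phi \in \mathrm{IAut}^+(E)\}$ (the factors $m$, $\phi$ of an element are unique), and let $p(m\phi) = \phi$. All these sets carry the strong operator topology. Assume that $p|_H$ is continuous for every compact subgroup $H$ of $\mathrm{Aut}^+(E)$ contained in $\mathrm{ZAut}^+(E)\cdot \mathrm{IAut}^+(E)$. Let $G$ be a group. A positive representation of $G$ in $E$ is a group homomorphism $\rho \colon G \to \mathrm{Aut}^+(E)$, $s \mapsto \rho_s$. (i) Let $\rho$ be a positive representation of $G$ in $E$ with $\rho(G) \subset \mathrm{ZAut}^+(E)\cdot \mathrm{IAut}^+(E)$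 and with compact image. Then there exist a unique positive representation $\pi \colon G \to \mathrm{IAut}^+(E)$ and a (not necessarily unique) $m \in \mathrm{ZAut}^+(E)$ such that $$\rho_s = m\, \pi_s\, m^{-1} \quad \text{for all } s \in G,$$ and the image of $\pi$ is compact. (ii) Conversely, for every positive representation $\pi \colon G \to \mathrm{IAut}^+(E)$ with compact image and every $m \in \mathrm{ZAut}^+(E)$, the formula $\rho_s = m \pi_s m^{-1}$ defines a positive representation $\rho$ of $G$ with compact image in $\mathrm{ZAut}^+(E)\cdot \mathrm{IAut}^+(E)$. (iii) If $\rho$ and $\pi$ correspond in this way and $G$ carries a topology, then $\rho$ is strongly continuous if and only if $\pi$ is strongly continuous. -/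

import Mathlib

open scoped Pointwise

section BanachLatticeAutomorphisms

variable (E : Type*) [NormedAddCommGroup E] [NormedSpace ℝ E] [Lattice E]

/-- The group `Aut⁺(E)` of lattice automorphisms of a Banach lattice `E`: the (bounded) linear
bijections of `E` that preserve the lattice operations. -/
def LatticeAut : Subgroup (E ≃L[ℝ] E) where
  carrier := {T | ∀ x y : E, T (x ⊔ y) = T x ⊔ T y ∧ T (x ⊓ y) = T x ⊓ T y}
  one_mem' := fun _ _ => ⟨rfl, rfl⟩
  mul_mem' := by
    intro S T hS hT x y
    refine ⟨?_, ?_⟩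
    · change S (T (x ⊔ y)) = S (T x) ⊔ S (T y)
      rw [(hT x y).1, (hS _ _).1]
    · change S (T (x ⊓ y)) = S (T x) ⊓ S (T y)
      rw [(hT x y).2, (hS _ _).2]
  inv_mem' := by
    intro T hT x y
    have key : ∀ z, T (T.symm z) = z := T.apply_symm_apply
    refine ⟨?_, ?_⟩
    · change T.symm (x ⊔ y) = T.symm x ⊔ T.symm y
      apply T.injective
      rw [(hT _ _).1, key, key, key]
    · change T.symm (x ⊓ y) = T.symm x ⊓ T.symm y
      apply T.injective
      rw [(hT _ _).2, key, key, key]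

/-- The strong operator topology on `Aut⁺(E)`: the topology induced from the bounded operators
on `E` with the topology of pointwise (norm) convergence. -/
noncomputable instance LatticeAut.instTopologicalSpace : TopologicalSpace (LatticeAut E) :=
  TopologicalSpace.induced
    (fun T => ContinuousLinearMap.toPointwiseConvergenceCLM ℝ (RingHom.id ℝ) E E
      ((T : E ≃L[ℝ] E) : E →L[ℝ] E))
    inferInstance

/-- The subgroup `IAut⁺(E)` of isometric lattice automorphisms. -/
def IsometricLatticeAut : Subgroup (LatticeAut E) where
  carrier := {T | ∀ x : E, ‖(T : E ≃L[ℝ] E) x‖ = ‖x‖}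
  one_mem' := fun _ => rfl
  mul_mem' := by
    intro S T hS hT x
    exact (hS _).trans (hT x)
  inv_mem' := by
    intro T hT x
    have h := hT ((T : E ≃L[ℝ] E).symm x)
    rw [(T : E ≃L[ℝ] E).apply_symm_apply] at h
    exact h.symm

variable {E} in
/-- A linear operator `m` is central if `-λ I ≤ m ≤ λ I` for some `λ ≥ 0`, in the order of
operators determined by the positive cone. (Such an operator is the difference of the positive
operators `m + λ I` and `λ I`, so it is automatically regular.) -/
def IsCentral (m : E →ₗ[ℝ] E) : Prop :=
  ∃ c : ℝ, 0 ≤ c ∧ ∀ x : E, 0 ≤ x → -(c • x) ≤ m x ∧ m x ≤ c • x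

/-- The set `ZAut⁺(E)` of central lattice automorphisms. -/
def CentralLatticeAut : Set (LatticeAut E) :=
  {T | IsCentral ((T : E ≃L[ℝ] E) : E →ₗ[ℝ] E)}

/-- The set `ZAut⁺(E) · IAut⁺(E)` of products `m φ` of a central lattice automorphism `m` and an
isometric lattice automorphism `φ`. -/
def FactorizableAut : Set (LatticeAut E) :=
  CentralLatticeAut E * (IsometricLatticeAut E : Set (LatticeAut E))

variable {E} in
theorem exists_isometricPart {T : LatticeAut E} (hT : T ∈ FactorizableAut E) :
    ∃ φ : IsometricLatticeAut E, ∃ m ∈ CentralLatticeAut E, T = m * φ := by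
  obtain ⟨m, hm, φ, hφ, rfl⟩ := Set.mem_mul.mp hT
  exact ⟨⟨φ, hφ⟩, m, hm, rfl⟩

/-- The map `p : ZAut⁺(E) · IAut⁺(E) → IAut⁺(E)`, `m φ ↦ φ`. On a Banach lattice the factors of
an element `m φ` are unique, so that the choice made here is no choice at all. -/
noncomputable def isometricPart (T : FactorizableAut E) : IsometricLatticeAut E :=
  (exists_isometricPart T.2).choose

/-- The standing assumption on `E`: the map `p : m φ ↦ φ` is continuous for the strong operator
topologies on every subgroup of `Aut⁺(E)` that is contained in `ZAut⁺(E) · IAut⁺(E)` and compact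
in the strong operator topology. -/
def IsometricPartContinuous : Prop :=
  ∀ (H : Subgroup (LatticeAut E)) (hH : (H : Set (LatticeAut E)) ⊆ FactorizableAut E),
    IsCompact (H : Set (LatticeAut E)) →
      Continuous fun T : H => isometricPart E ⟨(T : LatticeAut E), hH T.2⟩

end BanachLatticeAutomorphisms

/-! ### Disjointness in vector lattices -/

section VectorLattice

variable {E : Type*} [AddCommGroup E] [Lattice E] [IsOrderedAddMonoid E]

/-! For a compact group `H` of factorizable automorphisms write `T = c(T) p(T)`. Central
automorphisms are stable under conjugation, so `p` is a homomorphism and `c` a cocycle: `S c(T) =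
c(ST) p(S)`. Averaging over Haar measure, `m = ∫ c(T) dT` satisfies `S m = m p(S)`, that is, `S = m
p(S) m⁻¹`.

The average is invertible because `M⁻¹ I ≤ c(T) ≤ M I` uniformly. Banach–Steinhaus bounds the norms
on `H`, and `le_norm_smul_of_bandPreserving` turns norm bounds into order bounds. Continuity of `p`
on `H` makes the integrand continuous. Uniqueness of `π` rests on `eq_one_of_central_of_isometric`.
The other claims hold since conjugation by `m` is a homeomorphism. -/

theorem add_inf_eq_zero_of_nonneg {a b q : E} (ha : 0 ≤ a) (hb : 0 ≤ b) (hq : 0 ≤ q)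
    (haq : a ⊓ q = 0) (hbq : b ⊓ q = 0) : (a + b) ⊓ q = 0 := by
  refine le_antisymm ?_ (le_inf (add_nonneg ha hb) hq)
  have h : (a + b) ⊓ q - b ≤ a ⊓ q :=
    le_inf (sub_le_iff_le_add.2 inf_le_left) ((sub_le_self _ hb).trans inf_le_right)
  rw [haq, sub_nonpos] at h
  exact (le_inf h inf_le_right).trans hbq.le

variable [Module ℝ E]

theorem smul_inf_eq_zero_of_nonneg [IsOrderedModule ℝ E] {c : ℝ} {a b : E} (hc : 0 ≤ c)
    (ha : 0 ≤ a) (hb : 0 ≤ b) (hab : a ⊓ b = 0) : (c • a) ⊓ b = 0 := by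
  refine le_antisymm ?_ (le_inf (smul_nonneg hc ha) hb)
  -- Scaling by `max c 1` is an order isomorphism, even if `c = 0`, and dominates both `c • a` and
  -- `b`.
  have hd : 0 < max c 1 := lt_max_of_lt_right one_pos
  have h := (OrderIso.smulRight (β := E) hd).map_inf a b
  simp only [OrderIso.smulRight_apply, hab, smul_zero] at h
  rw [h]
  refine inf_le_inf (smul_le_smul_of_nonneg_right (le_max_left _ _) ha) ?_
  simpa using smul_le_smul_of_nonneg_right (le_max_right c 1) hb

/-- A positive linear map that sends disjoint positive elements to disjoint elements preserves the
lattice operations. -/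
theorem map_sup_and_map_inf_of_map_disjoint {T : E →ₗ[ℝ] E}
    (hdis : ∀ x y, 0 ≤ x → 0 ≤ y → x ⊓ y = 0 → T x ⊓ T y = 0) (x y : E) :
    T (x ⊔ y) = T x ⊔ T y ∧ T (x ⊓ y) = T x ⊓ T y := by
  have hpos : T (x - y)⁺ = (T (x - y))⁺ := by
    have h0 := hdis _ _ (posPart_nonneg (x - y)) (negPart_nonneg (x - y))
      (posPart_inf_negPart_eq_zero _)
    have h1 : T (x - y) = T (x - y)⁺ - T (x - y)⁻ := by
      rw [← map_sub, posPart_sub_negPart]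
    have h2 := inf_eq_sub_posPart_sub (T (x - y)⁺) (T (x - y)⁻)
    rw [h0, ← h1] at h2
    exact sub_eq_zero.1 h2.symm
  refine ⟨?_, ?_⟩
  · rw [sup_eq_add_posPart_sub, sup_eq_add_posPart_sub (T x), map_add, hpos, map_sub]
  · rw [inf_eq_sub_posPart_sub, inf_eq_sub_posPart_sub (T x), map_sub, hpos, map_sub]

end VectorLattice

/-! ### Order bounds for band preserving operators -/

section BandPreserving

variable {E : Type*} [NormedAddCommGroup E] [NormedSpace ℝ E] [Lattice E] [IsOrderedAddMonoid E]
  [HasSolidNorm E]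

theorem norm_le_of_le_smul {T : E →L[ℝ] E} {c : ℝ} (hc : 0 ≤ c) (hpos : ∀ x, 0 ≤ x → 0 ≤ T x)
    (hle : ∀ x, 0 ≤ x → T x ≤ c • x) : ‖T‖ ≤ c := by
  refine T.opNorm_le_bound hc fun x => ?_
  have hmono : ∀ y z, y ≤ z → T y ≤ T z := fun y z h => by
    rw [← sub_nonneg, ← map_sub]
    exact hpos _ (sub_nonneg.2 h)
  have h1 : |T x| ≤ T |x| := by
    refine abs_le'.2 ⟨hmono _ _ (le_abs_self x), ?_⟩
    rw [← map_neg]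
    exact hmono _ _ (neg_le_abs x)
  have h2 : |T x| ≤ |c • (|x|)| :=
    (h1.trans (hle _ (abs_nonneg x))).trans (le_abs_self _)
  have h3 := norm_le_norm_of_abs_le_abs h2
  rwa [norm_smul, norm_abs_eq_norm, Real.norm_eq_abs, abs_of_nonneg hc] at h3

variable [CompleteSpace E]

/-- The Neumann series `R = (1 - A)⁻¹` is again positive and band preserving. For `u = x - A x`, `R
u = x ≥ 0` gives `R u⁻ ≤ R u⁺`; these are disjoint, so `R u⁻ = 0` and `u⁻ = 0`. -/
theorem le_of_bandPreserving_of_norm_lt_one {A : E →L[ℝ] E} (hA : ‖A‖ < 1)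
    (hpos : ∀ x, 0 ≤ x → 0 ≤ A x)
    (hdis : ∀ x y, 0 ≤ x → 0 ≤ y → x ⊓ y = 0 → A x ⊓ y = 0) {x : E} (hx : 0 ≤ x) : A x ≤ x := by
  set R : E →L[ℝ] E := ∑' n : ℕ, A ^ n with hR
  have hsum : ∀ z, HasSum (fun n : ℕ => (A ^ n) z) (R z) := fun z =>
    (ContinuousLinearMap.apply ℝ E z).hasSum (summable_geometric_of_norm_lt_one hA).hasSum
  have hpow : ∀ n : ℕ, ∀ z, 0 ≤ z → 0 ≤ (A ^ n) z := by
    intro n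
    induction n with
    | zero => intro z hz; simpa using hz
    | succ n ih => intro z hz; rw [pow_succ]; exact ih _ (hpos _ hz)
  have hpowdis : ∀ n : ℕ, ∀ y z, 0 ≤ y → 0 ≤ z → y ⊓ z = 0 → (A ^ n) y ⊓ z = 0 := by
    intro n
    induction n with
    | zero => intro y z _ _ h; simpa using h
    | succ n ih =>
      intro y z hy hz h
      rw [pow_succ]
      exact ih _ _ (hpos _ hy) hz (hdis _ _ hy hz h)
  have hRpos : ∀ z, 0 ≤ z → 0 ≤ R z := fun z hz =>
    (hsum z).nonneg fun n => hpow n z hz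
  have hRdis : ∀ y z, 0 ≤ y → 0 ≤ z → y ⊓ z = 0 → R y ⊓ z = 0 := by
    intro y z hy hz h
    have hfin : ∀ s : Finset ℕ, (∑ n ∈ s, (A ^ n) y) ⊓ z = 0 := by
      intro s
      induction s using Finset.induction_on with
      | empty => simpa using hz
      | insert a s ha ih =>
        rw [Finset.sum_insert ha]
        exact add_inf_eq_zero_of_nonneg (hpow _ _ hy)
          (Finset.sum_nonneg fun n _ => hpow n _ hy) hz (hpowdis _ _ _ hy hz h) ih
    have hlim : Filter.Tendsto (fun s : Finset ℕ => (∑ n ∈ s, (A ^ n) y) ⊓ z) Filter.atTop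
        (nhds (R y ⊓ z)) := (hsum y).inf_nhds tendsto_const_nhds
    simp only [hfin] at hlim
    exact tendsto_nhds_unique hlim tendsto_const_nhds
  have hl : R * (1 - A) = 1 := geom_series_mul_neg A hA
  have hr : (1 - A) * R = 1 := mul_neg_geom_series A hA
  set u : E := x - A x with hu
  have hRu : R u = x := by
    have := congrArg (fun B : E →L[ℝ] E => B x) hl
    simpa [hu] using this
  have hp := posPart_nonneg u
  have hn := negPart_nonneg u
  have h1 : R u⁺ ⊓ u⁻ = 0 := hRdis _ _ hp hn (posPart_inf_negPart_eq_zero _)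
  have h2 : R u⁻ ⊓ R u⁺ = 0 := hRdis _ _ hn (hRpos _ hp) (by rwa [inf_comm])
  have h3 : R u⁻ ≤ R u⁺ := by
    rw [← sub_nonneg, ← map_sub, posPart_sub_negPart, hRu]
    exact hx
  have h4 : R u⁻ = 0 := by rwa [inf_eq_left.2 h3] at h2
  have h5 : u⁻ = 0 := by
    have := congrArg (fun B : E →L[ℝ] E => B u⁻) hr
    simpa [h4] using this.symm
  exact sub_nonneg.1 (negPart_eq_zero.1 h5)

variable [IsOrderedModule ℝ E]

/-- The order unit norm of a positive band preserving operator is at most its operator norm. -/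
theorem le_norm_smul_of_bandPreserving {T : E →L[ℝ] E} (hpos : ∀ x, 0 ≤ x → 0 ≤ T x)
    (hdis : ∀ x y, 0 ≤ x → 0 ≤ y → x ⊓ y = 0 → T x ⊓ y = 0) {x : E} (hx : 0 ≤ x) :
    T x ≤ ‖T‖ • x := by
  -- Rescaling by `r⁻¹` makes the norm less than one; then `r` decreases to `‖T‖`.
  have key : ∀ r : ℝ, ‖T‖ < r → T x ≤ r • x := by
    intro r hr
    have hr0 : 0 < r := (norm_nonneg T).trans_lt hr
    have h := le_of_bandPreserving_of_norm_lt_one (A := r⁻¹ • T) (x := x) ?_ ?_ ?_ hx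
    · have h' := smul_le_smul_of_nonneg_left h hr0.le
      simpa [smul_smul, hr0.ne'] using h'
    · rw [norm_smul, Real.norm_eq_abs, abs_of_pos (inv_pos.2 hr0), inv_mul_lt_one₀ hr0]
      exact hr
    · intro z hz
      exact smul_nonneg (inv_nonneg.2 hr0.le) (hpos z hz)
    · intro y z hy hz h
      exact smul_inf_eq_zero_of_nonneg (inv_nonneg.2 hr0.le) (hpos y hy) hz (hdis y z hy hz h)
  have hlim : Filter.Tendsto (fun r : ℝ => r • x) (nhdsWithin ‖T‖ (Set.Ioi ‖T‖))
      (nhds (‖T‖ • x)) :=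
    ((continuous_id.smul continuous_const).tendsto' _ _ rfl).mono_left nhdsWithin_le_nhds
  refine ge_of_tendsto hlim ?_
  filter_upwards [self_mem_nhdsWithin] with r hr using key r hr

end BandPreserving

/-! ### Central and isometric automorphisms -/

namespace LatticeAut

section Order

variable {E : Type*} [NormedAddCommGroup E] [NormedSpace ℝ E] [Lattice E]

theorem mul_apply (S T : LatticeAut E) (x : E) : (S * T).1 x = S.1 (T.1 x) := rfl

theorem inv_apply_self (T : LatticeAut E) (x : E) : T⁻¹.1 (T.1 x) = x :=
  T.1.symm_apply_apply x

theorem apply_inv_self (T : LatticeAut E) (x : E) : T.1 (T⁻¹.1 x) = x :=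
  T.1.apply_symm_apply x

theorem ext_apply {S T : LatticeAut E} (h : ∀ x, S.1 x = T.1 x) : S = T :=
  Subtype.ext (ContinuousLinearEquiv.ext (funext h))

theorem apply_mono (T : LatticeAut E) {x y : E} (h : x ≤ y) : T.1 x ≤ T.1 y := by
  rw [← sup_eq_right, ← (T.2 x y).1, sup_eq_right.2 h]

theorem apply_nonneg (T : LatticeAut E) {x : E} (hx : 0 ≤ x) : 0 ≤ T.1 x := by
  simpa using apply_mono T hx

theorem norm_le_one_of_isometric {T : LatticeAut E} (h : T ∈ IsometricLatticeAut E) :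
    ‖(T.1 : E →L[ℝ] E)‖ ≤ 1 :=
  ContinuousLinearMap.opNorm_le_bound _ zero_le_one fun x => by
    rw [one_mul]; exact (h x).le

theorem exists_eq_mul_isometricPart (T : FactorizableAut E) :
    ∃ m ∈ CentralLatticeAut E, (T : LatticeAut E) = m * isometricPart E T :=
  (exists_isometricPart T.2).choose_spec

variable [IsOrderedAddMonoid E] [IsOrderedModule ℝ E]

theorem mem_central_iff {T : LatticeAut E} :
    T ∈ CentralLatticeAut E ↔ ∃ c : ℝ, 0 ≤ c ∧ ∀ x, 0 ≤ x → T.1 x ≤ c • x := by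
  refine ⟨fun ⟨c, hc, h⟩ => ⟨c, hc, fun x hx => (h x hx).2⟩, fun ⟨c, hc, h⟩ =>
    ⟨c, hc, fun x hx => ⟨?_, h x hx⟩⟩⟩
  exact (neg_nonpos.2 (smul_nonneg hc hx)).trans (apply_nonneg T hx)

theorem mul_mem_central {S T : LatticeAut E} (hS : S ∈ CentralLatticeAut E)
    (hT : T ∈ CentralLatticeAut E) : S * T ∈ CentralLatticeAut E := by
  obtain ⟨c, hc, hS⟩ := mem_central_iff.1 hS
  obtain ⟨d, hd, hT⟩ := mem_central_iff.1 hT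
  refine mem_central_iff.2 ⟨c * d, mul_nonneg hc hd, fun x hx => ?_⟩
  rw [mul_apply, mul_smul]
  exact (hS _ (apply_nonneg T hx)).trans (smul_le_smul_of_nonneg_left (hT x hx) hc)

theorem conj_mem_central {T : LatticeAut E} (hT : T ∈ CentralLatticeAut E) (S : LatticeAut E) :
    S * T * S⁻¹ ∈ CentralLatticeAut E := by
  obtain ⟨c, hc, hT⟩ := mem_central_iff.1 hT
  refine mem_central_iff.2 ⟨c, hc, fun x hx => ?_⟩
  rw [mul_apply, mul_apply]
  refine (apply_mono S (hT _ (apply_nonneg S⁻¹ hx))).trans ?_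
  rw [map_smul, apply_inv_self]

theorem apply_inf_eq_zero {T : LatticeAut E} (hT : T ∈ CentralLatticeAut E) {x y : E}
    (hx : 0 ≤ x) (hy : 0 ≤ y) (h : x ⊓ y = 0) : T.1 x ⊓ y = 0 := by
  obtain ⟨c, hc, hT⟩ := mem_central_iff.1 hT
  refine le_antisymm ?_ (le_inf (apply_nonneg T hx) hy)
  exact (inf_le_inf_right _ (hT x hx)).trans (smul_inf_eq_zero_of_nonneg hc hx hy h).le

/-- Applying `T` reduces this to `x ⊓ T y = 0`. Thus `T⁻¹` is band preserving before any order bound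
on it is known, and `inv_mem_central` follows. -/
theorem inv_apply_inf_eq_zero {T : LatticeAut E} (hT : T ∈ CentralLatticeAut E) {x y : E}
    (hx : 0 ≤ x) (hy : 0 ≤ y) (h : x ⊓ y = 0) : T⁻¹.1 x ⊓ y = 0 := by
  apply T.1.injective
  rw [(T.2 _ _).2, apply_inv_self, map_zero, inf_comm]
  exact apply_inf_eq_zero hT hy hx (by rwa [inf_comm])

variable [HasSolidNorm E] [CompleteSpace E]

theorem apply_le_norm_smul {T : LatticeAut E} (hT : T ∈ CentralLatticeAut E) {x : E}
    (hx : 0 ≤ x) : T.1 x ≤ ‖(T.1 : E →L[ℝ] E)‖ • x :=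
  le_norm_smul_of_bandPreserving (T := (T.1 : E →L[ℝ] E)) (fun _ h => apply_nonneg T h)
    (fun _ _ hx hy h => apply_inf_eq_zero hT hx hy h) hx

theorem inv_apply_le_norm_smul {T : LatticeAut E} (hT : T ∈ CentralLatticeAut E) {x : E}
    (hx : 0 ≤ x) : T⁻¹.1 x ≤ ‖(T⁻¹.1 : E →L[ℝ] E)‖ • x :=
  le_norm_smul_of_bandPreserving (T := (T⁻¹.1 : E →L[ℝ] E)) (fun _ h => apply_nonneg T⁻¹ h)
    (fun _ _ hx hy h => inv_apply_inf_eq_zero hT hx hy h) hx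

theorem inv_mem_central {T : LatticeAut E} (hT : T ∈ CentralLatticeAut E) :
    T⁻¹ ∈ CentralLatticeAut E :=
  mem_central_iff.2 ⟨_, norm_nonneg _, fun _ hx => inv_apply_le_norm_smul hT hx⟩

theorem apply_le_of_isometric {T : LatticeAut E} (hT : T ∈ CentralLatticeAut E)
    (h : T ∈ IsometricLatticeAut E) {x : E} (hx : 0 ≤ x) : T.1 x ≤ x := by
  refine (apply_le_norm_smul hT hx).trans ?_
  simpa using smul_le_smul_of_nonneg_right (norm_le_one_of_isometric h) hx

/-- Both `T` and `T⁻¹` have norm at most one, so both lie below the identity on the positive cone.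
-/
theorem eq_one_of_central_of_isometric {T : LatticeAut E} (hT : T ∈ CentralLatticeAut E)
    (h : T ∈ IsometricLatticeAut E) : T = 1 := by
  have hpos : ∀ x, 0 ≤ x → T.1 x = x := fun x hx => by
    refine le_antisymm (apply_le_of_isometric hT h hx) ?_
    have h1 := apply_le_of_isometric (inv_mem_central hT) (inv_mem h) (apply_nonneg T hx)
    rwa [inv_apply_self] at h1
  refine ext_apply fun x => ?_
  rw [← posPart_sub_negPart x, map_sub, hpos _ (posPart_nonneg x), hpos _ (negPart_nonneg x)]
  rfl

theorem isometric_factor_unique {m n : LatticeAut E} {φ ψ : IsometricLatticeAut E}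
    (hm : m ∈ CentralLatticeAut E) (hn : n ∈ CentralLatticeAut E)
    (h : m * (φ : LatticeAut E) = n * ψ) : φ = ψ := by
  have h1 : n⁻¹ * m = ((ψ * φ⁻¹ : IsometricLatticeAut E) : LatticeAut E) := by
    push_cast
    rw [eq_mul_inv_iff_mul_eq, mul_assoc, h, inv_mul_cancel_left]
  have h2 := eq_one_of_central_of_isometric (mul_mem_central (inv_mem_central hn) hm)
    (h1 ▸ (ψ * φ⁻¹).2)
  rw [h2] at h1
  exact (mul_inv_eq_one.1 (Subtype.ext h1.symm)).symm

theorem isometricPart_eq {T : FactorizableAut E} {m : LatticeAut E} {φ : IsometricLatticeAut E}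
    (hm : m ∈ CentralLatticeAut E) (h : (T : LatticeAut E) = m * φ) : isometricPart E T = φ := by
  obtain ⟨n, hn, hT⟩ := (exists_isometricPart T.2).choose_spec
  exact isometric_factor_unique hn hm (hT.symm.trans h)

theorem conj_eq_mul {m : LatticeAut E} (φ : LatticeAut E) (hm : m ∈ CentralLatticeAut E) :
    ∃ n ∈ CentralLatticeAut E, m * φ * m⁻¹ = n * φ :=
  ⟨m * (φ * m⁻¹ * φ⁻¹), mul_mem_central hm (conj_mem_central (inv_mem_central hm) φ), by group⟩

theorem conj_mem_factorizable {m : LatticeAut E} (φ : IsometricLatticeAut E)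
    (hm : m ∈ CentralLatticeAut E) : m * (φ : LatticeAut E) * m⁻¹ ∈ FactorizableAut E := by
  obtain ⟨n, hn, h⟩ := conj_eq_mul φ hm
  rw [h]
  exact Set.mul_mem_mul hn φ.2

/-- On a group of factorizable automorphisms, taking the isometric part is a homomorphism. -/
noncomputable def isometricPartHom (H : Subgroup (LatticeAut E))
    (hH : (H : Set (LatticeAut E)) ⊆ FactorizableAut E) : H →* IsometricLatticeAut E :=
  MonoidHom.mk' (fun T => isometricPart E ⟨(T : LatticeAut E), hH T.2⟩) fun S T => by
    obtain ⟨m, hm, hS⟩ := exists_eq_mul_isometricPart ⟨(S : LatticeAut E), hH S.2⟩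
    obtain ⟨n, hn, hT⟩ := exists_eq_mul_isometricPart ⟨(T : LatticeAut E), hH T.2⟩
    set φ := isometricPart E ⟨(S : LatticeAut E), hH S.2⟩
    -- `(m φ)(n ψ) = m (φ n φ⁻¹) · φ ψ`.
    refine isometricPart_eq (mul_mem_central hm (conj_mem_central hn φ)) ?_
    change (S : LatticeAut E) * T = _
    dsimp only at hS hT
    conv_lhs => rw [hS, hT]
    push_cast
    group

theorem exists_eq_mul_isometricPartHom {H : Subgroup (LatticeAut E)}
    (hH : (H : Set (LatticeAut E)) ⊆ FactorizableAut E) (T : H) :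
    ∃ m ∈ CentralLatticeAut E, (T : LatticeAut E) = m * isometricPartHom H hH T :=
  exists_eq_mul_isometricPart ⟨(T : LatticeAut E), hH T.2⟩

end Order

/-! ### The strong operator topology on norm-bounded sets -/

section Topology

variable {E : Type*} [NormedAddCommGroup E] [NormedSpace ℝ E] [Lattice E]
  {α : Type*} [TopologicalSpace α]

theorem continuous_iff {f : α → LatticeAut E} :
    Continuous f ↔ ∀ x, Continuous fun a => (f a).1 x := by
  rw [continuous_induced_rng]
  refine ⟨fun h x => ?_, fun h => PointwiseConvergenceCLM.continuous_of_continuous_eval h⟩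
  exact (continuous_eval_const (F := E →SLₚₜ[RingHom.id ℝ] E) x).comp h

theorem continuous_apply_const (x : E) : Continuous fun T : LatticeAut E => T.1 x :=
  continuous_iff.1 continuous_id x

theorem continuous_apply_of_norm_le {f : α → LatticeAut E} {v : α → E} {M : ℝ}
    (hf : Continuous f) (hv : Continuous v) (hM : ∀ a, ‖((f a).1 : E →L[ℝ] E)‖ ≤ M) :
    Continuous fun a => (f a).1 (v a) := by
  refine continuous_iff_continuousAt.2 fun a₀ => ?_
  have h1 : Filter.Tendsto (fun a => (f a).1 (v a - v a₀)) (nhds a₀) (nhds 0) := by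
    refine squeeze_zero_norm (a := fun a => M * ‖v a - v a₀‖) (fun a => ?_) ?_
    · exact ((f a).1 : E →L[ℝ] E).le_of_opNorm_le (hM a) _
    · have h : Continuous fun a => M * ‖v a - v a₀‖ := by fun_prop
      exact h.tendsto' _ _ (by simp)
  have h2 := h1.add ((continuous_iff.1 hf (v a₀)).tendsto a₀)
  simpa [ContinuousAt] using h2

theorem continuous_mul_of_norm_le {f g : α → LatticeAut E} {M : ℝ}
    (hf : Continuous f) (hg : Continuous g) (hM : ∀ a, ‖((f a).1 : E →L[ℝ] E)‖ ≤ M) :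
    Continuous fun a => f a * g a :=
  continuous_iff.2 fun x => continuous_apply_of_norm_le (v := fun a => (g a).1 x) hf
    (continuous_iff.1 hg x) hM

/-- With `y = (f a₀)⁻¹ x`, the difference `(f a)⁻¹ x - y` equals `(f a)⁻¹ (x - f a y)`, which the
uniform bound controls. -/
theorem continuous_inv_of_norm_le {f : α → LatticeAut E} {M : ℝ}
    (hf : Continuous f) (hM : ∀ a, ‖((f a)⁻¹.1 : E →L[ℝ] E)‖ ≤ M) :
    Continuous fun a => (f a)⁻¹ := by
  refine continuous_iff.2 fun x => continuous_iff_continuousAt.2 fun a₀ => ?_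
  set y := (f a₀)⁻¹.1 x with hy
  have h1 : Filter.Tendsto (fun a => (f a)⁻¹.1 (x - (f a).1 y)) (nhds a₀) (nhds 0) := by
    refine squeeze_zero_norm (a := fun a => M * ‖x - (f a).1 y‖) (fun a => ?_) ?_
    · exact ((f a)⁻¹.1 : E →L[ℝ] E).le_of_opNorm_le (hM a) _
    · have h := continuous_iff.1 hf y
      have h' : Continuous fun a => M * ‖x - (f a).1 y‖ := by fun_prop
      exact h'.tendsto' _ _ (by rw [hy, apply_inv_self, sub_self, norm_zero, mul_zero])
  have h2 := h1.add_const y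
  rw [zero_add] at h2
  refine h2.congr fun a => ?_
  rw [map_sub, inv_apply_self, sub_add_cancel]

theorem continuous_conj (m : LatticeAut E) :
    Continuous fun T : LatticeAut E => m * T * m⁻¹ :=
  continuous_iff.2 fun x => m.1.continuous.comp (continuous_apply_const (m⁻¹.1 x))

theorem continuous_conj_iff {m : LatticeAut E} {f : α → LatticeAut E} :
    (Continuous fun a => m * f a * m⁻¹) ↔ Continuous f := by
  refine ⟨fun h => ?_, fun h => (continuous_conj m).comp h⟩
  have h' := (continuous_conj m⁻¹).comp h
  convert h' using 1
  ext1 a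
  simp [mul_assoc]

theorem exists_norm_le_of_isCompact [CompleteSpace E] {K : Set (LatticeAut E)}
    (hK : IsCompact K) : ∃ M : ℝ, ∀ T ∈ K, ‖(T.1 : E →L[ℝ] E)‖ ≤ M := by
  have h := banach_steinhaus (g := fun T : K => (T.1.1 : E →L[ℝ] E)) fun x => by
    obtain ⟨C, hC⟩ := hK.exists_bound_of_continuousOn (continuous_apply_const x).continuousOn
    exact ⟨C, fun T => hC T T.2⟩
  obtain ⟨M, hM⟩ := h
  exact ⟨M, fun T hT => hM ⟨T, hT⟩⟩

theorem isTopologicalGroup_of_isCompact [CompleteSpace E] {H : Subgroup (LatticeAut E)}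
    (hH : IsCompact (H : Set (LatticeAut E))) : IsTopologicalGroup H := by
  obtain ⟨M, hM⟩ := exists_norm_le_of_isCompact hH
  refine { continuous_mul := ?_, continuous_inv := ?_ }
  · exact Continuous.subtype_mk (continuous_mul_of_norm_le (M := M)
      (continuous_subtype_val.comp continuous_fst) (continuous_subtype_val.comp continuous_snd)
      fun a => hM _ a.1.2) _
  · exact Continuous.subtype_mk (continuous_inv_of_norm_le (M := M) continuous_subtype_val
      fun a => hM _ (inv_mem a.2)) _

end Topology

/-! ### Haar averaging of the central parts -/

section Integral

open MeasureTheory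

variable {E : Type*} [NormedAddCommGroup E] [NormedSpace ℝ E] [CompleteSpace E]
  [Lattice E] [IsOrderedAddMonoid E] [IsOrderedModule ℝ E] [HasSolidNorm E]

/-- A bounded operator between two strictly positive multiples of the identity is a central lattice
automorphism. -/
theorem exists_central_of_bounds {N : E →L[ℝ] E} {M : ℝ} (hM : 1 ≤ M)
    (hle : ∀ x, 0 ≤ x → N x ≤ M • x) (hge : ∀ x, 0 ≤ x → M⁻¹ • x ≤ N x) :
    ∃ m ∈ CentralLatticeAut E, ∀ x, m.1 x = N x := by
  have hM0 : 0 < M := one_pos.trans_le hM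
  have hr : 0 ≤ 1 - M⁻¹ * M⁻¹ :=
    sub_nonneg.2 (mul_le_one₀ (inv_le_one_of_one_le₀ hM) (inv_nonneg.2 hM0.le)
      (inv_le_one_of_one_le₀ hM))
  have hr1 : 1 - M⁻¹ * M⁻¹ < 1 := sub_lt_self _ (by positivity)
  -- On the positive cone `0 ≤ I - M⁻¹ N ≤ (1 - M⁻²) I`, so `M⁻¹ N` is invertible by a Neumann
  -- series.
  have hnorm : ‖(1 : E →L[ℝ] E) - M⁻¹ • N‖ ≤ 1 - M⁻¹ * M⁻¹ := by
    refine norm_le_of_le_smul hr (fun x hx => ?_) fun x hx => ?_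
    · have h := smul_le_smul_of_nonneg_left (hle x hx) (inv_nonneg.2 hM0.le)
      rw [inv_smul_smul₀ hM0.ne'] at h
      simpa using h
    · have h := smul_le_smul_of_nonneg_left (hge x hx) (inv_nonneg.2 hM0.le)
      rw [smul_smul] at h
      simpa [sub_smul, sub_add_eq_add_sub, le_sub_iff_add_le] using h
  have hunit : IsUnit (M⁻¹ • N) := by
    have h := isUnit_one_sub_of_norm_lt_one (hnorm.trans_lt hr1)
    rwa [sub_sub_cancel] at h
  have hunit' : IsUnit N := by
    have h := hunit.smul (Units.mk0 M hM0.ne')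
    rwa [Units.smul_mk0, smul_inv_smul₀ hM0.ne'] at h
  obtain ⟨U, hU⟩ := hunit'
  have happ : ∀ x, ContinuousLinearEquiv.unitsEquiv ℝ E U x = N x := fun x => by
    rw [ContinuousLinearEquiv.unitsEquiv_apply, hU]
  have hpos : ∀ x, 0 ≤ x → 0 ≤ N x := fun x hx =>
    (smul_nonneg (inv_nonneg.2 hM0.le) hx).trans (hge x hx)
  refine ⟨⟨ContinuousLinearEquiv.unitsEquiv ℝ E U, fun x y => ?_⟩, ?_, happ⟩
  · simp only [happ]
    refine map_sup_and_map_inf_of_map_disjoint (T := (N : E →ₗ[ℝ] E)) (fun x y hx hy h => ?_) x y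
    have h1 : N x ⊓ y = 0 := le_antisymm ((inf_le_inf_right _ (hle x hx)).trans
      (smul_inf_eq_zero_of_nonneg hM0.le hx hy h).le) (le_inf (hpos x hx) hy)
    refine le_antisymm ((inf_le_inf_left _ (hle y hy)).trans ?_) (le_inf (hpos x hx) (hpos y hy))
    rw [inf_comm]
    exact (smul_inf_eq_zero_of_nonneg hM0.le hy (hpos x hx) (by rwa [inf_comm])).le
  · refine mem_central_iff.2 ⟨M, hM0.le, fun x hx => ?_⟩
    exact (happ x).trans_le (hle x hx)

/-- A compact group of factorizable automorphisms is conjugate, by a central lattice automorphism,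
to the group of its isometric parts: average the central parts over the Haar measure. -/
theorem exists_central_conj {H : Subgroup (LatticeAut E)}
    (hH : (H : Set (LatticeAut E)) ⊆ FactorizableAut E)
    (hcomp : IsCompact (H : Set (LatticeAut E)))
    (hcont : Continuous (isometricPartHom H hH)) :
    ∃ m ∈ CentralLatticeAut E, ∀ T : H,
      (T : LatticeAut E) = m * (isometricPartHom H hH T : LatticeAut E) * m⁻¹ := by
  set q := isometricPartHom H hH with hq
  have : IsTopologicalGroup H := isTopologicalGroup_of_isCompact hcomp
  have : CompactSpace H := isCompact_iff_compactSpace.1 hcomp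
  obtain ⟨M₀, hM₀⟩ := exists_norm_le_of_isCompact hcomp
  set M := max M₀ 1 with hMdef
  have hM1 : 1 ≤ M := le_max_right _ _
  have hM0 : 0 < M := one_pos.trans_le hM1
  have hM : ∀ T : H, ‖(T.1.1 : E →L[ℝ] E)‖ ≤ M := fun T => (hM₀ T T.2).trans (le_max_left _ _)
  set c : H → LatticeAut E := fun T => T * ((q T : LatticeAut E))⁻¹ with hc
  have hqiso : ∀ T x, ‖(q T).1.1 x‖ = ‖x‖ := fun T => (q T).2
  have hqiso' : ∀ T x, ‖((q T).1⁻¹).1 x‖ = ‖x‖ := fun T => (q T)⁻¹.2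
  have hcontc : Continuous c := by
    refine continuous_mul_of_norm_le (M := M) continuous_subtype_val ?_ hM
    exact continuous_inv_of_norm_le (M := 1) (continuous_subtype_val.comp hcont) fun T =>
      norm_le_one_of_isometric (q T)⁻¹.2
  have hcentral : ∀ T, c T ∈ CentralLatticeAut E := fun T => by
    obtain ⟨m, hm, h⟩ := exists_eq_mul_isometricPartHom hH T
    have : c T = m := by rw [hc, mul_inv_eq_iff_eq_mul]; exact h
    rwa [this]
  have hnorm : ∀ T, ‖((c T).1 : E →L[ℝ] E)‖ ≤ M := fun T => by
    refine ContinuousLinearMap.opNorm_le_bound _ hM0.le fun x => ?_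
    refine (ContinuousLinearMap.le_of_opNorm_le (T.1.1 : E →L[ℝ] E) (hM T) _).trans_eq ?_
    exact congrArg (M * ·) (hqiso' T x)
  have hnorm' : ∀ T, ‖((c T)⁻¹.1 : E →L[ℝ] E)‖ ≤ M := fun T => by
    refine ContinuousLinearMap.opNorm_le_bound _ hM0.le fun x => ?_
    -- An isometry after an element of `H`, so the bound `M` on `H` applies.
    have hinv : (c T)⁻¹ = (q T : LatticeAut E) * (T⁻¹ : H) := by simp [hc]
    change ‖(c T)⁻¹.1 x‖ ≤ _
    rw [hinv, mul_apply, hqiso]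
    exact ContinuousLinearMap.le_of_opNorm_le ((T⁻¹ : H).1.1 : E →L[ℝ] E) (hM T⁻¹) _
  have hle : ∀ T x, 0 ≤ x → (c T).1 x ≤ M • x := fun T x hx =>
    (apply_le_norm_smul (hcentral T) hx).trans (smul_le_smul_of_nonneg_right (hnorm T) hx)
  have hge : ∀ T x, 0 ≤ x → M⁻¹ • x ≤ (c T).1 x := fun T x hx => by
    have hy := apply_nonneg (c T) hx
    have h := (inv_apply_le_norm_smul (hcentral T) hy).trans
      (smul_le_smul_of_nonneg_right (hnorm' T) hy)
    rw [inv_apply_self] at h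
    have h' := smul_le_smul_of_nonneg_left h (inv_nonneg.2 hM0.le)
    rwa [inv_smul_smul₀ hM0.ne'] at h'
  let _ : MeasurableSpace H := borel H
  have : BorelSpace H := ⟨rfl⟩
  let μ : Measure H := Measure.haarMeasure ⊤
  have hμ : IsProbabilityMeasure μ := ⟨by
    simpa using Measure.haarMeasure_self (K₀ := (⊤ : TopologicalSpace.PositiveCompacts H))⟩
  have hint : ∀ x, Integrable (fun T => (c T).1 x) μ := fun x =>
    (continuous_iff.1 hcontc x).integrable_of_hasCompactSupport
      (HasCompactSupport.of_compactSpace _)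
  let N : E →L[ℝ] E := LinearMap.mkContinuous
    { toFun := fun x => ∫ T, (c T).1 x ∂μ
      map_add' := fun x y => by
        simp only [map_add]
        exact integral_add (hint x) (hint y)
      map_smul' := fun r x => by
        simp only [map_smul]
        exact integral_smul r _ } M fun x => by
      refine (norm_integral_le_of_norm_le_const (C := M * ‖x‖) (Filter.Eventually.of_forall
        fun T => ContinuousLinearMap.le_of_opNorm_le ((c T).1 : E →L[ℝ] E) (hnorm T) x)).trans ?_
      simp
  have hN : ∀ x, N x = ∫ T, (c T).1 x ∂μ := fun x => rfl
  obtain ⟨m, hm, hmN⟩ := exists_central_of_bounds (N := N) hM1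
    (fun x hx => by
      rw [hN]
      simpa using integral_mono (hint x) (integrable_const (M • x)) fun T => hle T x hx)
    (fun x hx => by
      rw [hN]
      simpa using integral_mono (integrable_const (M⁻¹ • x)) (hint x) fun T => hge T x hx)
  refine ⟨m, hm, fun S => ?_⟩
  rw [eq_mul_inv_iff_mul_eq]
  refine ext_apply fun x => ?_
  -- By left invariance, `∫ c(T) q(S) x = ∫ c(ST) q(S) x = ∫ S c(T) x`.
  rw [mul_apply, mul_apply, hmN, hmN, hN, hN,
    ← integral_mul_left_eq_self (fun T => (c T).1 ((q S).1.1 x)) S]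
  have h := ((S.1.1 : E →L[ℝ] E)).integral_comp_comm (hint x)
  refine Eq.trans h.symm (integral_congr_ae (Filter.Eventually.of_forall fun T => ?_))
  change (S.1 * c T).1 x = (c (S * T) * (q S : LatticeAut E)).1 x
  congr 2
  simp [hc, mul_assoc]

end Integral

end LatticeAut

/-! ### The correspondence between `ρ` and `π` -/

open LatticeAut in
theorem theoremt
    (E : Type*) [NormedAddCommGroup E] [NormedSpace ℝ E] [CompleteSpace E]
    [Lattice E] [IsOrderedAddMonoid E] [IsOrderedModule ℝ E] [HasSolidNorm E]
    (hE : IsometricPartContinuous E)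
    (G : Type*) [Group G] :
    (∀ ρ : G →* LatticeAut E, (∀ s, ρ s ∈ FactorizableAut E) → IsCompact (Set.range ρ) →
      (∃! π : G →* IsometricLatticeAut E, ∃ m ∈ CentralLatticeAut E,
        ∀ s, ρ s = m * (π s : LatticeAut E) * m⁻¹) ∧
      (∀ π : G →* IsometricLatticeAut E, ∀ m ∈ CentralLatticeAut E,
        (∀ s, ρ s = m * (π s : LatticeAut E) * m⁻¹) → IsCompact (Set.range π))) ∧
    (∀ π : G →* IsometricLatticeAut E, IsCompact (Set.range π) →
      ∀ m ∈ CentralLatticeAut E, ∃ ρ : G →* LatticeAut E,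
        (∀ s, ρ s = m * (π s : LatticeAut E) * m⁻¹) ∧
        (∀ s, ρ s ∈ FactorizableAut E) ∧ IsCompact (Set.range ρ)) ∧
    (∀ (_ : TopologicalSpace G) (ρ : G →* LatticeAut E) (π : G →* IsometricLatticeAut E),
      ∀ m ∈ CentralLatticeAut E,
        (∀ s, ρ s = m * (π s : LatticeAut E) * m⁻¹) → (Continuous ρ ↔ Continuous π)) := by
  refine ⟨fun ρ hρ hcomp => ⟨?_, ?_⟩, ?_, ?_⟩
  · have hH : (ρ.range : Set (LatticeAut E)) ⊆ FactorizableAut E := by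
      rintro _ ⟨s, rfl⟩
      exact hρ s
    have hcomp' : IsCompact (ρ.range : Set (LatticeAut E)) := by
      rwa [MonoidHom.coe_range]
    obtain ⟨m, hm, h⟩ := exists_central_conj hH hcomp' (hE _ hH hcomp')
    refine ⟨(isometricPartHom ρ.range hH).comp ρ.rangeRestrict,
      ⟨m, hm, fun s => h (ρ.rangeRestrict s)⟩, ?_⟩
    rintro π ⟨n, hn, hπ⟩
    ext1 s
    -- Conjugating by a central `n` leaves the isometric part unchanged, so `ρ` determines `π`.
    obtain ⟨k, hk, hkπ⟩ := conj_eq_mul (π s : LatticeAut E) hn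
    exact (isometricPart_eq (T := ⟨ρ s, hρ s⟩) hk ((hπ s).trans hkπ)).symm
  · intro π m _ h
    rw [Subtype.isCompact_iff]
    convert hcomp.image (continuous_conj m⁻¹) using 1
    rw [← Set.range_comp, ← Set.range_comp]
    congr 1
    ext1 s
    simp [h, mul_assoc]
  · intro π hπ m hm
    let ρ : G →* LatticeAut E := (MulAut.conj m).toMonoidHom.comp
      ((IsometricLatticeAut E).subtype.comp π)
    refine ⟨ρ, fun s => rfl, fun s => conj_mem_factorizable (π s) hm, ?_⟩
    have h := hπ.image ((continuous_conj m).comp continuous_subtype_val)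
    rwa [← Set.range_comp] at h
  · intro _ ρ π m _ h
    have h1 : (ρ : G → LatticeAut E) = fun s => m * (π s : LatticeAut E) * m⁻¹ := funext h
    rw [h1, continuous_conj_iff]
    exact (Topology.IsEmbedding.subtypeVal.continuous_iff (f := π)).symm
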